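/- Let $a\ge 2$ be an integer. A digraph $D$ is a finite vertex set $V(D)$ with a set $A(D)$ of ordered pairs of distinct vertices (arcs). It is balanced bipartite with colour classes of cardinality $a$ if $V(D)$ is a disjoint union of sets $X$ and $Y$ with $|X|=|Y|=a$ and no arc has both ends in $X$ or both ends in $Y$. The degree of a vertex is the sum of its outdegree and its indegree, and $\delta(D)$ is the minimum degree of the vertices of $D$. A digraph is hamiltonian if it contains an oriented cycle passing through all its vertices. Theorem. Let $D$ be a balanced bipartite digraph with colour classes of cardinality $a$, where $a\ge 2$. If $\delta(D)\ge \frac{3a+1}{2}$, then $D$ is hamiltonian, that is, $D$ contains an oriented cycle of length $2a$. Moreover, the bound is sharp: for every $a\ge 2$ there is a non-hamiltonian balanced bipartite digraph with colour classes of cardinality $a$ and minimum degree $\lfloor 3a/2\rfloor$, the largest integer smaller than $\frac{3a+1}{2}$. -/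

import Mathlib

namespace Digraph

variable {V : Type*}

/-- `D` is a balanced bipartite digraph with colour classes of cardinality `a`: the vertex set is
the disjoint union of two sets `X`, `Y` of cardinality `a`, and no arc has both ends in `X` or both
ends in `Y`. (In particular `D` has no loops, and it has `2 * a` vertices.) -/
def IsBalancedBipartite (D : Digraph V) (a : ℕ) : Prop :=
  ∃ X Y : Finset V, Disjoint X Y ∧ (∀ v, v ∈ X ∨ v ∈ Y) ∧ X.card = a ∧ Y.card = a ∧
    (∀ u ∈ X, ∀ v ∈ X, ¬ D.Adj u v) ∧ (∀ u ∈ Y, ∀ v ∈ Y, ¬ D.Adj u v)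

/-- The outdegree of `v`: the number of vertices dominated by `v`. -/
noncomputable def outDeg (D : Digraph V) (v : V) : ℕ := {u | D.Adj v u}.ncard

/-- The indegree of `v`: the number of vertices dominating `v`. -/
noncomputable def inDeg (D : Digraph V) (v : V) : ℕ := {u | D.Adj u v}.ncard

/-- The (total) degree of `v`. -/
noncomputable def deg (D : Digraph V) (v : V) : ℕ := D.outDeg v + D.inDeg v

/-- The minimal degree of `D` (attained at some vertex as soon as `V` is non-empty). -/
noncomputable def minDeg (D : Digraph V) : ℕ := ⨅ v : V, D.deg v

/-- `[v₁, …, vₘ]` is an oriented cycle of `D`: its `m ≥ 2` vertices are pairwise distinct, and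
`v₁v₂, …, vₘ₋₁vₘ, vₘv₁` are arcs of `D`. -/
def IsOrientedCycle (D : Digraph V) (c : Cycle V) : Prop :=
  c.Nodup ∧ 2 ≤ c.length ∧ c.Chain D.Adj

/-- `D` contains an oriented cycle passing through all the vertices of `D`. -/
def IsHamiltonian (D : Digraph V) : Prop :=
  ∃ c : Cycle V, D.IsOrientedCycle c ∧ ∀ v, v ∈ c

end Digraph

open Finset Equiv.Perm

namespace Digraph

/-! By Hall's theorem the degree bound gives a cycle factor: a permutation `σ` with an arc from each
`v` to `σ v`. Take one with the most pairs of vertices sharing a cycle. If `u`, `w` lie on different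
cycles, the arcs `u → σ w` and `w → σ u` cannot both exist, as `σ * swap u w` would merge the two
cycles. So for a cycle `S` and `u ∈ S`, the sets `{w | u → σ w}` and `{w | w → σ u}` lie in the
colour class of `u` and meet only inside `S`, whence `d⁺(u) + d⁻(σ u) ≤ a + #S / 2`. Averaging over
`S` (`two_mul_sum_degree_le`) gives `#S > a` for every cycle, so there is only one. -/

/-- A spanning cycle factor that is a single orbit is a hamiltonian cycle. -/
theorem isHamiltonian_of_sameCycle {V : Type*} [Fintype V] [DecidableEq V] {D : Digraph V}
    (σ : Equiv.Perm V) (hσ : ∀ v, D.Adj v (σ v)) (hne : ∀ v, σ v ≠ v) (x : V)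
    (h : ∀ v, σ.SameCycle x v) : D.IsHamiltonian := by
  have hx : x ∈ σ.support := mem_support.2 (hne x)
  refine ⟨(σ.toList x : Cycle V), ⟨?_, ?_, ?_⟩, ?_⟩
  · exact Cycle.nodup_coe_iff.2 (nodup_toList σ x)
  · exact two_le_length_toList_iff_mem_support.2 hx
  · have key : ∀ (n : ℕ) (y : V), List.IsChain D.Adj (List.iterate σ y n ++ [(σ ^ n) y]) := by
      intro n
      induction n with
      | zero => intro y; simp
      | succ n ih =>
        intro y
        have h2 := ih (σ y)
        rw [List.iterate, List.cons_append, pow_succ, mul_apply]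
        refine List.IsChain.cons h2 ?_
        intro z hz
        cases n with
        | zero => simp at hz; subst hz; exact hσ y
        | succ n => simp [List.iterate] at hz; subst hz; exact hσ y
    have hl : (σ ^ (σ.cycleOf x).support.card) x = x := by
      rw [← (isCycle_cycleOf σ (hne x)).orderOf]
      rw [← cycleOf_pow_apply_self, pow_orderOf_eq_one, one_apply]
    have h1 := key (σ.cycleOf x).support.card x
    rw [hl] at h1
    have h2 : σ.toList x = List.iterate σ x (σ.cycleOf x).support.card := rfl
    rw [← h2] at h1
    have h3 : (σ.toList x).head? = some x := by
      rw [h2]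
      cases hk : (σ.cycleOf x).support.card with
      | zero =>
        rw [Finset.card_eq_zero, support_eq_empty_iff, cycleOf_eq_one_iff] at hk
        exact absurd hk (hne x)
      | succ n => rfl
    cases hL : σ.toList x with
    | nil => simp [hL] at h3
    | cons b l =>
      rw [hL] at h1 h3
      simp at h3
      subst h3
      exact (Cycle.chain_coe_cons _ _ _).2 (by simpa using h1)
  · intro v
    exact Cycle.mem_coe_iff.2 (mem_toList_iff.2 ⟨h v, hx⟩)

/-- Multiplying by a transposition of points in different cycles merges these cycles. -/
theorem sameCycle_mul_swap {V : Type*} [Finite V] [DecidableEq V] (σ : Equiv.Perm V) {x y : V}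
    (h : ¬ σ.SameCycle x y) : (σ * Equiv.swap x y).SameCycle x y := by
  by_contra hxy
  set τ := σ * Equiv.swap x y with hτ
  -- From `x`, `τ` jumps to `σ y` and then follows the `σ`-cycle of `y`; by assumption it never
  -- meets `y`, yet that cycle returns there.
  have key : ∀ k : ℕ, τ.SameCycle x ((σ ^ (k + 1)) y) := by
    intro k
    induction k with
    | zero =>
      have : τ x = σ y := by simp [hτ]
      simp only [zero_add, pow_one, ← this]
      exact sameCycle_apply_right.2 (SameCycle.refl _ _)
    | succ k ih =>
      have h1 : (σ ^ (k + 1)) y ≠ x := fun e => h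
        (e ▸ (sameCycle_pow_left.2 (SameCycle.refl σ y)))
      have h2 : (σ ^ (k + 1)) y ≠ y := fun e => hxy (e ▸ ih)
      have h3 : τ ((σ ^ (k + 1)) y) = (σ ^ (k + 1 + 1)) y := by
        rw [hτ, mul_apply, Equiv.swap_apply_of_ne_of_ne h1 h2, pow_succ' σ (k + 1), mul_apply]
      rw [← h3]
      exact sameCycle_apply_right.2 ih
  obtain ⟨n, hn⟩ : ∃ n, orderOf σ = n + 1 := Nat.exists_eq_succ_of_ne_zero (orderOf_pos σ).ne'
  have := key n
  rw [← hn, pow_orderOf_eq_one] at this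
  exact hxy this

/-- Merging separates no pair: each step `w → σ w` stays within one cycle of the new permutation. -/
theorem sameCycle_mul_swap_of_sameCycle {V : Type*} [Finite V] [DecidableEq V] (σ : Equiv.Perm V)
    {x y : V}
    (h : ¬ σ.SameCycle x y) {u v : V} (huv : σ.SameCycle u v) :
    (σ * Equiv.swap x y).SameCycle u v := by
  have hxy := sameCycle_mul_swap σ h
  set τ := σ * Equiv.swap x y with hτ
  have step : ∀ w, τ.SameCycle w (σ w) := by
    intro w
    by_cases h1 : w = x
    · subst h1
      have : τ y = σ w := by simp [hτ]
      rw [← this]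
      exact sameCycle_apply_right.2 hxy
    by_cases h2 : w = y
    · subst h2
      have : τ x = σ w := by simp [hτ]
      rw [← this]
      exact sameCycle_apply_right.2 hxy.symm
    · have : τ w = σ w := by rw [hτ, mul_apply, Equiv.swap_apply_of_ne_of_ne h1 h2]
      rw [← this]
      exact sameCycle_apply_right.2 (SameCycle.refl _ _)
  obtain ⟨n, rfl⟩ := huv.exists_nat_pow_eq
  clear huv
  induction n with
  | zero => exact SameCycle.refl _ _
  | succ n ih => rw [pow_succ', mul_apply]; exact ih.trans (step _)

/-! ### Cycle factors and degree counting in a 2-coloured digraph. -/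

section Coloured

variable {V : Type*} [Fintype V] {D : Digraph V} {c : V → Bool} {a : ℕ}

open scoped Classical in
theorem card_out_le (hc : ∀ u v, D.Adj u v → c u ≠ c v) (hcard : ∀ b, #{v | c v = b} = a)
    (v : V) : #{w | D.Adj v w} ≤ a := by
  rw [← hcard (!c v)]
  refine card_le_card fun w hw => ?_
  have := hc _ _ (mem_filter.1 hw).2
  simp only [mem_filter, mem_univ, true_and]
  cases h1 : c v <;> cases h2 : c w <;> simp_all

open scoped Classical in
theorem card_in_le (hc : ∀ u v, D.Adj u v → c u ≠ c v) (hcard : ∀ b, #{v | c v = b} = a)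
    (v : V) : #{w | D.Adj w v} ≤ a := by
  rw [← hcard (!c v)]
  refine card_le_card fun w hw => ?_
  have := hc _ _ (mem_filter.1 hw).2
  simp only [mem_filter, mem_univ, true_and]
  cases h1 : c v <;> cases h2 : c w <;> simp_all

open scoped Classical in
/-- Hall's condition for a monochromatic set of vertices. -/
theorem card_le_card_outNeighbours_of_monochromatic
    (hc : ∀ u v, D.Adj u v → c u ≠ c v) (hcard : ∀ b, #{v | c v = b} = a)
    (hdeg : ∀ v, 3 * a + 1 ≤ 2 * (#{w | D.Adj v w} + #{w | D.Adj w v}))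
    (b : Bool) (S : Finset V) (hS : ∀ s ∈ S, c s = b) :
    #S ≤ #{v | ∃ s ∈ S, D.Adj s v} := by
  by_contra! hlt
  obtain ⟨s, hs⟩ : S.Nonempty := card_pos.1 (by omega)
  have hSa : #S ≤ a := by
    rw [← hcard b]
    exact card_le_card fun s hs => by simpa using hS s hs
  obtain ⟨y, hy, hyN⟩ : ∃ y ∈ ({v | c v = !b} : Finset V),
      y ∉ ({v | ∃ s ∈ S, D.Adj s v} : Finset V) :=
    exists_mem_notMem_of_card_lt_card (by rw [hcard]; omega)
  simp only [mem_filter, mem_univ, true_and, not_exists, not_and] at hy hyN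
  have h1 : #{w | D.Adj s w} ≤ #{v | ∃ s ∈ S, D.Adj s v} :=
    card_le_card fun w hw => by
      simp only [mem_filter, mem_univ, true_and] at hw ⊢
      exact ⟨s, hs, hw⟩
  have h2 : #{w | D.Adj w y} + #S ≤ a := by
    rw [← hcard b, ← card_union_of_disjoint]
    · refine card_le_card fun w hw => ?_
      simp only [mem_union, mem_filter, mem_univ, true_and] at hw ⊢
      rcases hw with hw | hw
      · have := hc _ _ hw
        cases b <;> cases h2 : c w <;> simp_all
      · exact hS w hw
    · rw [disjoint_left]
      intro w hw hwS
      exact hyN w hwS (by simpa using hw)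
  -- The degrees of `s` and `y` sum to at most `(#S - 1) + a + (a - #S) + a = 3a - 1`, but to at
  -- least `3a + 1`.
  have := card_in_le hc hcard s
  have := card_out_le hc hcard y
  have := hdeg s
  have := hdeg y
  omega

open scoped Classical in
/-- The minimum degree condition implies the existence of a cycle factor. -/
theorem exists_cycleFactor
    (hc : ∀ u v, D.Adj u v → c u ≠ c v) (hcard : ∀ b, #{v | c v = b} = a)
    (hdeg : ∀ v, 3 * a + 1 ≤ 2 * (#{w | D.Adj v w} + #{w | D.Adj w v})) :
    ∃ σ : Equiv.Perm V, ∀ v, D.Adj v (σ v) := by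
  obtain ⟨f, hf, hadj⟩ := (Fintype.all_card_le_filter_rel_iff_exists_injective D.Adj).1 (by
    intro A
    have h1 := card_le_card_outNeighbours_of_monochromatic hc hcard hdeg true {v ∈ A | c v = true}
      (by simp)
    have h2 := card_le_card_outNeighbours_of_monochromatic hc hcard hdeg false
      {v ∈ A | ¬ c v = true} (by simp)
    rw [← card_filter_add_card_filter_not (s := A) (fun v => c v = true)]
    refine (add_le_add h1 h2).trans ?_
    rw [← card_union_of_disjoint]
    · refine card_le_card fun w hw => ?_
      simp only [mem_union, mem_filter, mem_univ, true_and] at hw ⊢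
      rcases hw with ⟨s, hs, hw⟩ | ⟨s, hs, hw⟩
      exacts [⟨s, hs.1, hw⟩, ⟨s, hs.1, hw⟩]
    · rw [disjoint_left]
      intro w hw hw'
      simp only [mem_filter, mem_univ, true_and] at hw hw'
      obtain ⟨s, hs, hsw⟩ := hw
      obtain ⟨t, ht, htw⟩ := hw'
      have := hc _ _ hsw
      have := hc _ _ htw
      cases h : c w <;> simp_all)
  exact ⟨Equiv.ofBijective f (Finite.injective_iff_bijective.1 hf), hadj⟩

open scoped Classical in
/-- If no vertex of the invariant set `S` can be used to merge it with the rest of the cycle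
factor, then the degrees in `S` are at most `a + #S / 2` on average. -/
theorem two_mul_sum_degree_le (hc : ∀ u v, D.Adj u v → c u ≠ c v)
    (hcard : ∀ b, #{v | c v = b} = a) (σ : Equiv.Perm V) (hσ : ∀ v, D.Adj v (σ v))
    (S : Finset V) (hS : ∀ v, σ v ∈ S ↔ v ∈ S)
    (hmerge : ∀ u ∈ S, ∀ w ∉ S, D.Adj u (σ w) → ¬ D.Adj w (σ u)) :
    2 * ∑ v ∈ S, (#{w | D.Adj v w} + #{w | D.Adj w v}) ≤ #S * (2 * a + #S) := by
  have hflip : ∀ v, c (σ v) = !c v := fun v => by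
    have := hc _ _ (hσ v)
    cases h1 : c v <;> cases h2 : c (σ v) <;> simp_all
  have hinout : ∀ {u v}, D.Adj u (σ v) → c v = c u := fun {u v} h => by
    have := hc _ _ h
    rw [hflip] at this
    cases h1 : c v <;> cases h2 : c u <;> simp_all
  have hle : ∀ b, #{v ∈ S | c v = b} ≤ #{v ∈ S | c v = !b} := fun b => by
    refine card_le_card_of_injOn σ (fun v hv => ?_) σ.injective.injOn
    simp only [coe_filter, Set.mem_ofPred_eq] at hv ⊢
    exact ⟨(hS v).2 hv.1, by rw [hflip, hv.2]⟩
  have hhalf : ∀ b, 2 * #{v ∈ S | c v = b} = #S := fun b => by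
    have h1 := hle b
    have h2 := hle (!b)
    have h3 := card_filter_add_card_filter_not (s := S) (fun v => c v = b)
    have h4 : ({v ∈ S | ¬ c v = b} : Finset V) = {v ∈ S | c v = !b} :=
      filter_congr fun v _ => by cases b <;> simp
    rw [h4] at h3
    rw [Bool.not_not] at h2
    omega
  have hout : ∀ u, #{w | D.Adj u w} = #{w | D.Adj u (σ w)} := fun u =>
    (card_bij (fun w _ => σ w) (by simp) (by simp)
      (fun w hw => ⟨σ.symm w, by simpa using hw, by simp⟩)).symm
  -- Shifting indegrees along `σ` pairs the outdegree of `u` with the indegree of `σ u`.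
  have hin : ∑ v ∈ S, #{w | D.Adj w v} = ∑ v ∈ S, #{w | D.Adj w (σ v)} :=
    (sum_bij (fun v _ => σ v) (fun v hv => (hS v).2 hv) (by simp)
      (fun w hw => ⟨σ.symm w, by rw [← hS]; simpa using hw, by simp⟩) (by simp)).symm
  rw [sum_add_distrib, hin, ← sum_add_distrib, mul_sum, ← smul_eq_mul (#S)]
  refine sum_le_card_nsmul _ _ _ fun u hu => ?_
  rw [hout]
  have h1 : ({w | D.Adj u (σ w)} : Finset V) ∪ ({w | D.Adj w (σ u)} : Finset V) ⊆
      ({w | c w = c u} : Finset V) := fun w hw => by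
    simp only [mem_union, mem_filter, mem_univ, true_and] at hw ⊢
    exact hw.elim hinout fun h => (hinout h).symm
  have h2 : ({w | D.Adj u (σ w)} : Finset V) ∩ ({w | D.Adj w (σ u)} : Finset V) ⊆
      {w ∈ S | c w = c u} := fun w hw => by
    simp only [mem_inter, mem_filter, mem_univ, true_and] at hw ⊢
    exact ⟨by_contra fun h => hmerge u hu w h hw.1 hw.2, hinout hw.1⟩
  have h3 := card_le_card h1
  have h4 := card_le_card h2
  have h5 := hhalf (c u)
  rw [hcard] at h3
  rw [← card_union_add_card_inter]
  omega

open scoped Classical in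
theorem isHamiltonian_of_degree (ha : 0 < a)
    (hc : ∀ u v, D.Adj u v → c u ≠ c v) (hcard : ∀ b, #{v | c v = b} = a)
    (hdeg : ∀ v, 3 * a + 1 ≤ 2 * (#{w | D.Adj v w} + #{w | D.Adj w v})) :
    D.IsHamiltonian := by
  obtain ⟨σ₀, hσ₀⟩ := exists_cycleFactor hc hcard hdeg
  obtain ⟨σ, hσ, hmax⟩ := exists_max_image
    ({σ | ∀ v, D.Adj v (σ v)} : Finset (Equiv.Perm V))
    (fun σ => #{p : V × V | σ.SameCycle p.1 p.2}) ⟨σ₀, by simpa using hσ₀⟩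
  simp only [mem_filter, mem_univ, true_and] at hσ hmax
  have hmerge : ∀ u w, ¬ σ.SameCycle u w → D.Adj u (σ w) → ¬ D.Adj w (σ u) := by
    intro u w huw h1 h2
    refine (hmax (σ * Equiv.swap u w) fun v => ?_).not_gt (card_lt_card ?_)
    · rw [mul_apply]
      by_cases hvu : v = u
      · simpa [hvu] using h1
      by_cases hvw : v = w
      · simpa [hvw] using h2
      rw [Equiv.swap_apply_of_ne_of_ne hvu hvw]
      exact hσ v
    · refine (ssubset_iff_of_subset fun p hp => ?_).2 ⟨(u, w), ?_, by simpa using huw⟩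
      · simp only [mem_filter, mem_univ, true_and] at hp ⊢
        exact sameCycle_mul_swap_of_sameCycle σ huw hp
      · simpa using sameCycle_mul_swap σ huw
  have hlarge : ∀ x, a < #{v | σ.SameCycle x v} := by
    intro x
    have h1 := two_mul_sum_degree_le hc hcard σ hσ {v | σ.SameCycle x v}
      (by simp [sameCycle_apply_right]) (fun u hu w hw => hmerge u w fun h => hw (by
        simp only [mem_filter, mem_univ, true_and] at hu ⊢
        exact hu.trans h))
    rw [mul_sum] at h1
    have h2 := card_nsmul_le_sum ({v | σ.SameCycle x v} : Finset V) _ _ fun v _ => hdeg v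
    rw [smul_eq_mul] at h2
    -- Cancelling `#S` leaves `3a + 1 ≤ 2a + #S`.
    have h3 := Nat.le_of_mul_le_mul_left (h2.trans h1)
      (card_pos.2 ⟨x, by simpa using SameCycle.refl σ x⟩)
    omega
  have huniv : Fintype.card V = 2 * a := by
    rw [← card_univ, ← card_filter_add_card_filter_not (s := univ) (fun v => c v = true), hcard]
    simp only [Bool.not_eq_true, hcard]
    omega
  obtain ⟨x, -⟩ : ({v | c v = true} : Finset V).Nonempty := card_pos.1 (by rw [hcard]; exact ha)
  refine isHamiltonian_of_sameCycle σ hσ (fun v h => hc _ _ (hσ v) (by rw [h])) x fun y => ?_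
  by_contra hxy
  have hdisj : Disjoint ({v | σ.SameCycle x v} : Finset V) ({v | σ.SameCycle y v} : Finset V) := by
    rw [disjoint_left]
    intro v h1 h2
    simp only [mem_filter, mem_univ, true_and] at h1 h2
    exact hxy (h1.trans h2.symm)
  have h1 := card_le_univ (({v | σ.SameCycle x v} : Finset V) ∪ ({v | σ.SameCycle y v} : Finset V))
  rw [card_union_of_disjoint hdisj, huniv] at h1
  have := hlarge x
  have := hlarge y
  omega

end Coloured

theorem minDeg_le {V : Type*} (D : Digraph V) (v : V) : D.minDeg ≤ D.deg v :=
  ciInf_le (OrderBot.bddBelow _) v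

open scoped Classical in
theorem deg_eq_card_add_card {V : Type*} [Fintype V] (D : Digraph V) (v : V) :
    D.deg v = #{w | D.Adj v w} + #{w | D.Adj w v} := by
  rw [deg, outDeg, inDeg, ← Set.ncard_coe_finset, ← Set.ncard_coe_finset, coe_filter_univ,
    coe_filter_univ]

theorem IsHamiltonian.of_minDeg {V : Type*} [Fintype V] {D : Digraph V} {a : ℕ} (ha : 0 < a)
    (hD : D.IsBalancedBipartite a) (h : 3 * a + 1 ≤ 2 * D.minDeg) : D.IsHamiltonian := by
  classical
  obtain ⟨X, Y, hXY, hcov, hX, hY, hXX, hYY⟩ := hD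
  have hmemY : ∀ v, v ∉ X ↔ v ∈ Y := fun v =>
    ⟨(hcov v).resolve_left, fun h h' => disjoint_left.1 hXY h' h⟩
  refine isHamiltonian_of_degree (c := fun v => decide (v ∈ X)) ha ?_ ?_ ?_
  · intro u v huv hcol
    rw [decide_eq_decide] at hcol
    by_cases hu : u ∈ X
    · exact hXX u hu v (hcol.1 hu) huv
    · exact hYY u ((hmemY u).1 hu) v ((hmemY v).1 (mt hcol.2 hu)) huv
  · intro b
    cases b
    · simpa [hmemY] using hY
    · simpa using hX
  · intro v
    have h1 := minDeg_le D v
    rw [deg_eq_card_add_card] at h1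
    omega

/-! ### Sharpness of the bound. -/

/-- The balanced bipartite digraph on `Bool × Fin a` which has all arcs between the two colour
classes except those going from the first `k` vertices of a class to the last `a - k` vertices of
the other. -/
def blockDigraph (a k : ℕ) : Digraph (Bool × Fin a) where
  Adj u v := u.1 ≠ v.1 ∧ ((u.2 : ℕ) < k → (v.2 : ℕ) < k)

theorem isBalancedBipartite_blockDigraph (a k : ℕ) :
    (blockDigraph a k).IsBalancedBipartite a := by
  refine ⟨{true} ×ˢ univ, {false} ×ˢ univ, ?_, ?_, by simp, by simp, ?_, ?_⟩
  · rw [disjoint_left]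
    rintro ⟨b, i⟩ h1 h2
    simp at h1 h2
    simp [h1] at h2
  · rintro ⟨b, i⟩
    cases b <;> simp
  all_goals
    rintro ⟨b, i⟩ h1 ⟨b', j⟩ h2 h
    simp at h1 h2
    exact h.1 (by simp [h1, h2])

theorem not_isHamiltonian_blockDigraph {a k : ℕ} (hk : 0 < k) (hka : k < a) :
    ¬ (blockDigraph a k).IsHamiltonian := by
  rintro ⟨c, ⟨-, -, hc⟩, hall⟩
  -- On `Prop`, `≤` is implication; a closed chain of implications makes all its terms equal.
  have h1 : Cycle.Chain (· ≤ ·) (c.map fun v : Bool × Fin a => ((v.2 : ℕ) < k)) := by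
    rw [Cycle.chain_map]
    exact hc.imp fun u v h => h.2
  have h2 := Cycle.forall_eq_of_chain h1
    (Cycle.mem_map.2 ⟨(true, ⟨0, by omega⟩), hall _, rfl⟩)
    (Cycle.mem_map.2 ⟨(true, ⟨k, hka⟩), hall _, rfl⟩)
  simp [hk] at h2

theorem ncard_opposite_setOf (a : ℕ) (b : Bool) (p : Fin a → Prop) [DecidablePred p] :
    {v : Bool × Fin a | b ≠ v.1 ∧ p v.2}.ncard = #{i | p i} := by
  rw [← Set.ncard_coe_finset,
    ← Set.ncard_image_of_injective (({i | p i} : Finset (Fin a)) : Set (Fin a))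
      (Prod.mk_right_injective (!b))]
  refine congrArg Set.ncard (Set.ext ?_)
  rintro ⟨b', i⟩
  cases b <;> cases b' <;> simp

theorem deg_blockDigraph {a k : ℕ} (hk : k ≤ a) (v : Bool × Fin a) :
    (blockDigraph a k).deg v = if (v.2 : ℕ) < k then a + k else a + (a - k) := by
  have hout : (blockDigraph a k).outDeg v = #{i : Fin a | (v.2 : ℕ) < k → (i : ℕ) < k} :=
    ncard_opposite_setOf a v.1 fun i => (v.2 : ℕ) < k → (i : ℕ) < k
  have hin : (blockDigraph a k).inDeg v = #{i : Fin a | (i : ℕ) < k → (v.2 : ℕ) < k} := by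
    rw [← ncard_opposite_setOf a v.1 fun i => (i : ℕ) < k → (v.2 : ℕ) < k]
    exact congrArg Set.ncard (Set.ext fun u => and_congr_left fun _ => ne_comm)
  have hlt : #{i : Fin a | (i : ℕ) < k} = k := by
    rw [Fin.card_filter_val_lt, min_eq_right hk]
  have hge := card_filter_add_card_filter_not (s := univ) (fun i : Fin a => (i : ℕ) < k)
  rw [hlt, card_univ, Fintype.card_fin] at hge
  rw [deg, hout, hin]
  split_ifs with h
  · simp only [h, forall_const, implies_true, filter_true, card_univ, Fintype.card_fin, hlt]
    omega
  · simp only [h, false_implies, imp_false, filter_true, card_univ, Fintype.card_fin]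
    omega

theorem minDeg_blockDigraph {a k : ℕ} (hk : 0 < k) (hka : 2 * k ≤ a) :
    (blockDigraph a k).minDeg = a + k := by
  have hka' : k ≤ a := by omega
  apply le_antisymm
  · have := minDeg_le (blockDigraph a k) (true, ⟨0, by omega⟩)
    rwa [deg_blockDigraph hka', if_pos hk] at this
  · have : Nonempty (Bool × Fin a) := ⟨(true, ⟨0, by omega⟩)⟩
    refine le_ciInf fun v => ?_
    rw [deg_blockDigraph hka']
    split_ifs <;> omega

theorem IsBalancedBipartite.card_eq {V : Type*} [Fintype V] {D : Digraph V} {a : ℕ}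
    (hD : D.IsBalancedBipartite a) : Fintype.card V = 2 * a := by
  classical
  obtain ⟨X, Y, hXY, hcov, hX, hY, -, -⟩ := hD
  have : X ∪ Y = univ := eq_univ_of_forall fun v => mem_union.2 (hcov v)
  rw [← card_univ, ← this, card_union_of_disjoint hXY]
  omega

theorem length_eq_card_of_forall_mem {V : Type*} [Fintype V] {c : Cycle V} (hc : c.Nodup)
    (h : ∀ v, v ∈ c) : c.length = Fintype.card V := by
  classical
  induction c using Quotient.inductionOn' with
  | h l =>
    exact (List.toFinset_card_of_nodup hc).symm.trans
      (congrArg card (eq_univ_of_forall fun v => List.mem_toFinset.2 (h v)))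

end Digraph

/-- Here `3 * a / 2` in the second part is division in `ℕ`, that is, the floor of `3a/2`: the largest
integer smaller than `(3a+1)/2`. -/
theorem theorem1p9 (a : ℕ) (ha : 2 ≤ a) :
    (∀ (V : Type*) [Fintype V] (D : Digraph V), D.IsBalancedBipartite a →
      (3 * (a : ℚ) + 1) / 2 ≤ (D.minDeg : ℚ) →
      D.IsHamiltonian ∧ ∃ c : Cycle V, D.IsOrientedCycle c ∧ c.length = 2 * a) ∧
    (∃ (V : Type) (_ : Fintype V) (D : Digraph V), D.IsBalancedBipartite a ∧
      D.minDeg = 3 * a / 2 ∧ ¬ D.IsHamiltonian) := by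
  -- With `k = a / 2` the minimum degree is `a + a / 2 = 3 * a / 2`, and `a ≥ 2` ensures `0 < k <
  -- a`.
  refine ⟨fun V _ D hD hdeg => ?_, Bool × Fin a, inferInstance, Digraph.blockDigraph a (a / 2),
    Digraph.isBalancedBipartite_blockDigraph _ _, ?_,
    Digraph.not_isHamiltonian_blockDigraph (by omega) (by omega)⟩
  · have h : 3 * a + 1 ≤ 2 * D.minDeg := by
      rw [div_le_iff₀ two_pos, mul_comm (D.minDeg : ℚ)] at hdeg
      exact_mod_cast hdeg
    have hH := Digraph.IsHamiltonian.of_minDeg (by omega) hD h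
    refine ⟨hH, ?_⟩
    obtain ⟨c, hc, hall⟩ := hH
    exact ⟨c, hc, by rw [Digraph.length_eq_card_of_forall_mem hc.1 hall, hD.card_eq]⟩
  · rw [Digraph.minDeg_blockDigraph (by omega) (by omega)]
    omega
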